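/- All relational structures are multisorted: a signature consists of finitely many types and finitely many relation symbols, each symbol $R$ having as arity a finite (possibly empty) tuple $(t_1,\dots,t_n)$ of types; a structure $\mathbf A$ has a set $A_t$ for each type $t$ and a relation $R^{\mathbf A}\subseteq A_{t_1}\times\dots\times A_{t_n}$ for each $R$; homomorphisms are type-preserving maps that preserve all relations, and $\mathbf X\to\mathbf A$ means that one exists. A promise template is a pair $\mathbf A,\mathbf A'$ of structures of the same signature with $\mathbf A$ finite, $\mathbf A'$ possibly infinite, and $\mathbf A\to\mathbf A'$. An instance of $\mathrm{PCSP}(\mathbf A,\mathbf A')$ is a finite structure $\mathbf X$ of that signature, to be accepted if $\mathbf X\to\mathbf A$ and rejected if $\mathbf X\not\to\mathbf A'$. For a finite set $N$, let $\mathrm{Pol}(\mathbf A,\mathbf A')^{(N)}$ be the set of homomorphisms $f\colon\mathbf A^N\to\mathbf A'$, and for $\pi\colon N\to N'$ let $f^\pi\in\mathrm{Pol}(\mathbf A,\mathbf A')^{(N')}$ be given by $f^\pi(x)=f(x\circ\pi)$. A minion homomorphism $\mathrm{Pol}(\mathbf B,\mathbf B')\to\mathrm{Pol}(\mathbf A,\mathbf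 A')$ is a collection of maps $\xi_N\colon\mathrm{Pol}(\mathbf B,\mathbf B')^{(N)}\to\mathrm{Pol}(\mathbf A,\mathbf A')^{(N)}$, one for each finite set $N$, with $\xi_{N'}(f^\pi)=\xi_N(f)^\pi$ for all $\pi\colon N\to N'$; the two templates may have different signatures. Let $k\ge 1$. For a set $K$ of elements of $\mathbf X$ let $\mathcal F_K$ be the set of partial homomorphisms from $K$ to $\mathbf A$, i.e. type-preserving maps $K\to\mathbf A$ that preserve every tuple of every relation of $\mathbf X$ all of whose entries lie in $K$. The $k$-th level of the Sherali–Adams relaxation, $\mathrm{SA}^k(\mathbf X)$, is the linear program over $\mathbb Q$ with variables $x_{K,f}\in[0,1]$, for each set $K$ of at most $k$ elements of $\mathbf X$ and each $f\in\mathcal F_K$, and equations $$\sum_{f\in\mathcal F_K}x_{K,f}=1\ \ (|K|\le k),\qquad \sum_{f\in\mathcal F_K,\ f|_L=g}x_{K,f}=x_{L,g}\ \ (L\subseteq K,\ |K|\le k,\ g\in\mathcal F_L).$$ The $k$-th level solves $\mathrm{PCSP}(\mathbf A,\mathbf A')$ if, for every instance $\mathbf X$, the program $\mathrm{SA}^k(\mathbf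 X)$ is feasible whenever $\mathbf X\to\mathbf A$ (this always holds) and infeasible whenever $\mathbf X\not\to\mathbf A'$. **Corollary 4.3.** Let $\mathbf A,\mathbf A'$ and $\mathbf B,\mathbf B'$ be two promise templates such that there is a minion homomorphism $\mathrm{Pol}(\mathbf B,\mathbf B')\to\mathrm{Pol}(\mathbf A,\mathbf A')$. If $\mathrm{PCSP}(\mathbf B,\mathbf B')$ is solved by the $k$-th level of the Sherali–Adams relaxation for some $k\ge1$, then $\mathrm{PCSP}(\mathbf A,\mathbf A')$ is solved by the $\ell$-th level for some $\ell\ge1$. -/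

import Mathlib

open scoped Classical

universe u v

namespace PCSP

/-- A multisorted relational signature: the arity of a symbol `R` is the tuple
`ar R 0, …, ar R (len R - 1)` of types (nullary symbols are allowed). -/
structure Signature where
  Typ : Type
  Sym : Type
  len : Sym → ℕ
  ar : (R : Sym) → Fin (len R) → Typ

/-- A signature is finite if it has finitely many types and finitely many symbols. -/
class Signature.IsFinite (S : Signature) : Prop where
  typ : Finite S.Typ
  sym : Finite S.Sym

/-- A multisorted relational structure of signature `S`. -/
structure Struct (S : Signature) where
  dom : S.Typ → Type*
  rel : (R : S.Sym) → Set ((i : Fin (S.len R)) → dom (S.ar R i))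

/-- Over a finite signature, a structure is finite if each of its domains is finite. -/
class Struct.IsFinite {S : Signature} (A : Struct S) : Prop where
  dom : ∀ t, Finite (A.dom t)

attribute [instance] Struct.IsFinite.dom

/-- The elements of a structure; elements of different types are always different. -/
abbrev Struct.Elem {S : Signature} (A : Struct S) : Type _ := Σ t : S.Typ, A.dom t

/-- Homomorphisms of structures. -/
structure Hom {S : Signature} (A : Struct S) (B : Struct S) where
  toFun : (t : S.Typ) → A.dom t → B.dom t
  map_rel : ∀ (R : S.Sym), ∀ a ∈ A.rel R, (fun i => toFun (S.ar R i) (a i)) ∈ B.rel R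

/-- `A → B`: there is a homomorphism from `A` to `B`. -/
def MapsTo {S : Signature} (A : Struct S) (B : Struct S) : Prop := Nonempty (Hom A B)

/-- The `N`-fold power `A^N` of a structure. -/
def Struct.power {S : Signature} (A : Struct S) (N : Type) : Struct S where
  dom t := N → A.dom t
  rel R := {b | ∀ n : N, (fun i => b i n) ∈ A.rel R}

/-- `Pol A A' N` is the set of polymorphisms of `(A, A')` of arity `N`, i.e. of homomorphisms
`A^N → A'`. -/
abbrev Pol {S : Signature} (A : Struct S) (A' : Struct S) (N : Type) : Type _ :=
  Hom (A.power N) A'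

/-- The minor `f^π` of a polymorphism `f` along `π : N → N'`: `f^π(x) = f(x ∘ π)`. -/
def Pol.minor {S : Signature} {A : Struct S} {A' : Struct S} {N N' : Type}
    (π : N → N') (f : Pol A A' N) : Pol A A' N' where
  toFun t x := f.toFun t (x ∘ π)
  map_rel R b hb := f.map_rel R (fun i => b i ∘ π) fun n => hb (π n)

/-- A minion homomorphism `Pol(B, B') → Pol(A, A')`: a map `Pol(B, B')^(N) → Pol(A, A')^(N)` for
every finite set `N`, commuting with taking minors. -/
structure PolMinionHom {S T : Signature} (B : Struct T) (B' : Struct T)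
    (A : Struct S) (A' : Struct S) where
  map : (N : Type) → [Finite N] → Pol B B' N → Pol A A' N
  map_minor : ∀ (N N' : Type) [Finite N] [Finite N'] (π : N → N') (f : Pol B B' N),
    map N' (Pol.minor π f) = Pol.minor π (map N f)

/-- Partial homomorphisms from a finite set `K` of elements of `X` to `A`: type-preserving maps
`K → A` that preserve all constraints of `X` whose scope lies in `K`. -/
@[ext]
structure PartialHom {S : Signature} (X : Struct S) (A : Struct S) (K : Finset X.Elem) where
  toFun : (v : K) → A.dom v.1.1
  map_rel : ∀ (R : S.Sym), ∀ a ∈ X.rel R, ∀ h : ∀ i, (⟨S.ar R i, a i⟩ : X.Elem) ∈ K,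
    (fun i => toFun ⟨⟨S.ar R i, a i⟩, h i⟩) ∈ A.rel R

/-- The restriction `f|_L` of a partial homomorphism. -/
def PartialHom.restrict {S : Signature} {X : Struct S} {A : Struct S} {K L : Finset X.Elem}
    (hLK : L ⊆ K) (f : PartialHom X A K) : PartialHom X A L where
  toFun v := f.toFun ⟨v.1, hLK v.2⟩
  map_rel R a ha h := f.map_rel R a ha fun i => hLK (h i)

noncomputable instance PartialHom.instFintype {S : Signature} (X : Struct S) (A : Struct S)
    [A.IsFinite] (K : Finset X.Elem) : Fintype (PartialHom X A K) :=
  have : Finite (PartialHom X A K) :=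
    Finite.of_injective (fun f => f.toFun) fun _ _ h => PartialHom.ext h
  Fintype.ofFinite _

/-- `x` is a feasible solution of the linear program `SA^k(X)` with template `A`. The variables
are the `x K f` with `|K| ≤ k`; the values of `x` at larger sets `K` are irrelevant. -/
structure IsSASolution {S : Signature} (k : ℕ) (A : Struct S) [A.IsFinite] (X : Struct S)
    (x : (K : Finset X.Elem) → PartialHom X A K → ℚ) : Prop where
  mem_Icc : ∀ K : Finset X.Elem, K.card ≤ k → ∀ f, x K f ∈ Set.Icc (0 : ℚ) 1
  sum_eq_one : ∀ K : Finset X.Elem, K.card ≤ k → ∑ f, x K f = 1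
  marginal : ∀ (L K : Finset X.Elem) (hLK : L ⊆ K), K.card ≤ k → ∀ g : PartialHom X A L,
    ∑ f with PartialHom.restrict hLK f = g, x K f = x L g

/-- `SA^k(X)` has a feasible solution. -/
def SAFeasible {S : Signature} (k : ℕ) (A : Struct S) [A.IsFinite] (X : Struct S) : Prop :=
  ∃ x, IsSASolution k A X x

/-- The `k`-th level of the Sherali–Adams relaxation solves `PCSP(A, A')`: it accepts all the finite
instances `X` with `X → A` and it rejects all those with `X ↛ A'`. -/
def SolvedBySA {S : Signature} (k : ℕ) (A : Struct S) [A.IsFinite] (A' : Struct S) : Prop :=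
  (∀ X : Struct.{0} S, X.IsFinite → MapsTo X A → SAFeasible k A X) ∧
  (∀ X : Struct.{0} S, X.IsFinite → ¬ MapsTo X A' → ¬ SAFeasible k A X)

/-- `PCSP(A, A')` is solved by some level `k ≥ 1` of the Sherali–Adams hierarchy. -/
def SolvedBySomeSALevel {S : Signature} (A : Struct S) [A.IsFinite] (A' : Struct S) : Prop :=
  ∃ k : ℕ, 1 ≤ k ∧ SolvedBySA k A A'

end PCSP

/-! Fix `m ≥ 1` bounding the arities of `S`. Given an instance `X` for `A`, glue the powers `B^F(U)`
over all `|U| ≤ m`, where `F(U)` is the set of partial homomorphisms `U → A`, along restrictions;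
this is an instance for `B`. Soundness (`mapsTo_of_glued_mapsTo`): a homomorphism from it to `B'` is
a family of polymorphisms of arities `F(U)` compatible with minors. The minion homomorphism carries
it to such a family for `(A, A')`, and evaluating at the coordinate maps `f ↦ f v` yields `X → A'`.
Completeness (`safeasible_glued`): a solution of level `(k + 3) * m` for `X` gives random partial
homomorphisms `f`; evaluating representatives of glued elements at `f` pushes it forward to a
solution of level `k`. `LocalElem.eval_eq_eval` shows that on the support the choice of
representative is immaterial. -/

namespace PCSP

/-! ### Supports of Sherali–Adams solutions -/

section SupportOfSolutions

variable {S : Signature} {X A : Struct S}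

/-- The partial homomorphism induced on `K` by a homomorphism. -/
def Hom.toPartialHom (φ : Hom X A) (K : Finset X.Elem) : PartialHom X A K where
  toFun v := φ.toFun v.1.1 v.1.2
  map_rel R a ha _ := φ.map_rel R a ha

theorem safeasible_of_mapsTo [A.IsFinite] (k : ℕ) (h : MapsTo X A) : SAFeasible k A X := by
  obtain ⟨φ⟩ := h
  refine ⟨fun K f => if f = φ.toPartialHom K then 1 else 0, ?_, ?_, ?_⟩
  · intro K _ f
    split_ifs <;> simp
  · intro K _
    simp
  · intro L K hLK _ g
    have hr : PartialHom.restrict hLK (φ.toPartialHom K) = φ.toPartialHom L := rfl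
    simp [Finset.sum_ite_eq', hr, eq_comm]

variable [A.IsFinite] {l : ℕ} {x : (K : Finset X.Elem) → PartialHom X A K → ℚ}

theorem IsSASolution.restrict_ne_zero (hx : IsSASolution l A X x) {L K : Finset X.Elem}
    (hLK : L ⊆ K) (hK : K.card ≤ l) {f : PartialHom X A K} (hf : x K f ≠ 0) :
    x L (f.restrict hLK) ≠ 0 := by
  rw [← hx.marginal L K hLK hK]
  intro h0
  rw [Finset.sum_eq_zero_iff_of_nonneg fun f _ => (hx.mem_Icc K hK f).1] at h0
  exact hf (h0 f (by simp))

theorem IsSASolution.exists_extension (hx : IsSASolution l A X x) {L K : Finset X.Elem}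
    (hLK : L ⊆ K) (hK : K.card ≤ l) {g : PartialHom X A L} (hg : x L g ≠ 0) :
    ∃ f : PartialHom X A K, f.restrict hLK = g ∧ x K f ≠ 0 := by
  rw [← hx.marginal L K hLK hK] at hg
  obtain ⟨f, hf, hf0⟩ := Finset.exists_ne_zero_of_sum_ne_zero hg
  exact ⟨f, by simpa using hf, hf0⟩

end SupportOfSolutions

/-! ### The glued instance and its homomorphisms to `B'` -/

section Gluing

variable {S T : Signature}

/-- The elements of sort `s` of the powers `B^F(U)`, where `F(U)` is the set of partial homomorphisms
from `U` to `A`, for all sets `U` of at most `m` elements of `X`. -/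
abbrev LocalElem (m : ℕ) (X A : Struct.{0} S) (B : Struct.{0} T) (s : T.Typ) : Type :=
  Σ U : {U : Finset X.Elem // U.card ≤ m}, (PartialHom X A U.1 → B.dom s)

/-- The identification of an element of `B^F(V)` with its image in `B^F(U)`, for `V ⊆ U`. -/
def LocalElem.Glue {m : ℕ} {X A : Struct.{0} S} {B : Struct.{0} T} {s : T.Typ}
    (p q : LocalElem m X A B s) : Prop :=
  ∃ h : q.1.1 ⊆ p.1.1, p.2 = q.2 ∘ PartialHom.restrict h

/-- The structure obtained from the powers `B^F(U)`, `|U| ≤ m`, by gluing along restrictions. -/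
def glued (m : ℕ) (X A : Struct.{0} S) (B : Struct.{0} T) : Struct.{0} T where
  dom s := Quot (LocalElem.Glue (m := m) (X := X) (A := A) (B := B) (s := s))
  rel r := {b | ∃ (U : {U : Finset X.Elem // U.card ≤ m})
    (y : (i : Fin (T.len r)) → PartialHom X A U.1 → B.dom (T.ar r i)),
    y ∈ (B.power (PartialHom X A U.1)).rel r ∧ b = fun i => Quot.mk _ ⟨U, y i⟩}

variable {m : ℕ} {X A : Struct.{0} S} {B : Struct.{0} T}

theorem glued_isFinite [S.IsFinite] [A.IsFinite] [B.IsFinite] (hX : X.IsFinite) :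
    (glued m X A B).IsFinite := by
  have := Signature.IsFinite.typ (S := S)
  have : Finite X.Elem := inferInstance
  have : Finite (Finset X.Elem) := inferInstance
  refine ⟨fun s => ?_⟩
  have : Finite (LocalElem m X A B s) := inferInstance
  exact Finite.of_surjective _ Quot.mk_surjective

/-- The polymorphism of `(B, B')` given by the restriction of a homomorphism to `B^F(U)`. -/
def gluedPol {B' : Struct T} (F : Hom (glued m X A B) B') (U : Finset X.Elem) (hU : U.card ≤ m) :
    Pol B B' (PartialHom X A U) where
  toFun s x := F.toFun s (Quot.mk _ ⟨⟨U, hU⟩, x⟩)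
  map_rel r y hy := F.map_rel r _ ⟨⟨U, hU⟩, y, hy, rfl⟩

theorem gluedPol_minor {B' : Struct T} (F : Hom (glued m X A B) B') {U V : Finset X.Elem}
    (hU : U.card ≤ m) (hV : V.card ≤ m) (h : V ⊆ U) :
    Pol.minor (PartialHom.restrict h) (gluedPol F U hU) = gluedPol F V hV := by
  have : (Pol.minor (PartialHom.restrict h) (gluedPol F U hU)).toFun = (gluedPol F V hV).toFun := by
    funext s x
    exact congrArg (F.toFun s) (Quot.sound ⟨h, rfl⟩)
  revert this
  generalize Pol.minor (PartialHom.restrict h) (gluedPol F U hU) = f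
  generalize gluedPol F V hV = g
  intro h
  cases f
  cases g
  cases h
  rfl

theorem mapsTo_of_glued_mapsTo [A.IsFinite] {A' : Struct S} {B' : Struct T}
    (ξ : PolMinionHom B B' A A') (hm : 1 ≤ m) (hlen : ∀ R, S.len R ≤ m)
    (h : MapsTo (glued m X A B) B') : MapsTo X A' := by
  obtain ⟨F⟩ := h
  have h1 : ∀ v : X.Elem, ({v} : Finset X.Elem).card ≤ m := fun v => by simpa using hm
  let ev (U : Finset X.Elem) (v : X.Elem) (hv : v ∈ U) : PartialHom X A U → A.dom v.1 :=
    fun f => f.toFun ⟨v, hv⟩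
  let val (U : Finset X.Elem) (hU : U.card ≤ m) (v : X.Elem) (hv : v ∈ U) : A'.dom v.1 :=
    (ξ.map _ (gluedPol F U hU)).toFun v.1 (ev U v hv)
  have hval : ∀ (U : Finset X.Elem) (hU : U.card ≤ m) (v : X.Elem) (hv : v ∈ U),
      val {v} (h1 v) v (by simp) = val U hU v hv := by
    intro U hU v hv
    have hs : ({v} : Finset X.Elem) ⊆ U := by simpa using hv
    simp only [val]
    rw [← gluedPol_minor F hU (h1 v) hs, ξ.map_minor]
    -- Composing evaluation at `v` on `F({v})` with restriction from `F(U)` is evaluation at `v` on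
    -- `F(U)`.
    rfl
  refine ⟨⟨fun t a => val {⟨t, a⟩} (h1 _) ⟨t, a⟩ (by simp), fun R a ha => ?_⟩⟩
  let U : Finset X.Elem := Finset.univ.image fun i => (⟨S.ar R i, a i⟩ : X.Elem)
  have hU : U.card ≤ m := Finset.card_image_le.trans (by simpa using hlen R)
  have hmem : ∀ i, (⟨S.ar R i, a i⟩ : X.Elem) ∈ U := fun i =>
    Finset.mem_image_of_mem _ (Finset.mem_univ i)
  -- The evaluation maps form a tuple of the relation in `A^F(U)` precisely because every `f` in
  -- `F(U)` preserves the constraint `a`.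
  have := (ξ.map _ (gluedPol F U hU)).map_rel R
    (fun i => ev U ⟨S.ar R i, a i⟩ (hmem i)) fun f => f.map_rel R a ha hmem
  simp only [fun i => hval U hU ⟨S.ar R i, a i⟩ (hmem i)]
  exact this

/-! ### Evaluation is well defined on the support -/

/-- The value of an element of `B^F(U)` at the restriction to `U` of a partial homomorphism. -/
def LocalElem.eval {s : T.Typ} (p : LocalElem m X A B s) {W : Finset X.Elem} (h : p.1.1 ⊆ W)
    (f : PartialHom X A W) : B.dom s :=
  p.2 (f.restrict h)

section

variable [A.IsFinite] {l : ℕ} {x : (K : Finset X.Elem) → PartialHom X A K → ℚ}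

/-- A gluing chain may be arbitrarily long, but only its two endpoints and one intermediate element
need be in scope at once: extend `f` within the support to the intermediate index set, compare, and
forget it. Hence `3 * m`. -/
theorem LocalElem.eval_eq_eval (hx : IsSASolution l A X x) (hl : 3 * m ≤ l) {s : T.Typ}
    {p q : LocalElem m X A B s} (hpq : Quot.mk LocalElem.Glue p = Quot.mk LocalElem.Glue q)
    {W : Finset X.Elem} (hp : p.1.1 ⊆ W) (hq : q.1.1 ⊆ W) (hW : W.card ≤ l)
    {f : PartialHom X A W} (hf : x W f ≠ 0) : p.eval hp f = q.eval hq f := by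
  suffices H : ∀ (W : Finset X.Elem) (hp : p.1.1 ⊆ W) (hq : q.1.1 ⊆ W), W.card ≤ 2 * m →
      ∀ f : PartialHom X A W, x W f ≠ 0 → p.eval hp f = q.eval hq f by
    have hpqW : p.1.1 ∪ q.1.1 ⊆ W := Finset.union_subset hp hq
    refine H (p.1.1 ∪ q.1.1) Finset.subset_union_left Finset.subset_union_right ?_
      (f.restrict hpqW) (hx.restrict_ne_zero hpqW hW hf)
    have := Finset.card_union_le p.1.1 q.1.1
    have := p.1.2
    have := q.1.2
    omega
  clear hp hq hW hf f W
  induction Quot.eqvGen_exact hpq with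
  | rel p q h =>
    obtain ⟨h, e⟩ := h
    intro W hp hq _ f _
    simp only [LocalElem.eval, e]
    rfl
  | refl p => intros; rfl
  | symm p q h ih => exact fun W hp hq hW f hf => (ih (Quot.eqvGen_sound h) W hq hp hW f hf).symm
  | trans p q r h h' ih ih' =>
    intro W hp hr hW f hf
    have hWq : (W ∪ q.1.1).card ≤ l := by
      have := Finset.card_union_le W q.1.1
      have := q.1.2
      omega
    obtain ⟨g, rfl, hg⟩ := hx.exists_extension (K := W ∪ q.1.1) Finset.subset_union_left hWq hf
    have key : ∀ p' : LocalElem m X A B s, (hp' : p'.1.1 ⊆ W) →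
        (p'.1.1 ∪ q.1.1 ⊆ W ∪ q.1.1) ∧ (p'.1.1 ∪ q.1.1).card ≤ 2 * m := by
      intro p' hp'
      refine ⟨Finset.union_subset_union_left hp', ?_⟩
      have := Finset.card_union_le p'.1.1 q.1.1
      have := p'.1.2
      have := q.1.2
      omega
    exact (ih (Quot.eqvGen_sound h) (p.1.1 ∪ q.1.1) Finset.subset_union_left
      Finset.subset_union_right (key p hp).2 _
      (hx.restrict_ne_zero (key p hp).1 hWq hg)).trans
      (ih' (Quot.eqvGen_sound h') (r.1.1 ∪ q.1.1) Finset.subset_union_right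
      Finset.subset_union_left (key r hr).2 _
      (hx.restrict_ne_zero (key r hr).1 hWq hg))

end

/-! ### Pushing a solution forward to the glued instance -/

/-- A representative of an element of the glued structure. -/
noncomputable def gluedRep (e : (glued m X A B).Elem) : LocalElem m X A B e.1 :=
  Quot.out e.2

/-- The union of the index sets of the representatives of the elements of `K`. -/
noncomputable def gluedScope (K : Finset (glued m X A B).Elem) : Finset X.Elem :=
  K.biUnion fun e => (gluedRep e).1.1

theorem gluedRep_subset_gluedScope {K : Finset (glued m X A B).Elem} {e : (glued m X A B).Elem}
    (he : e ∈ K) : (gluedRep e).1.1 ⊆ gluedScope K :=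
  Finset.subset_biUnion_of_mem (fun e => (gluedRep e).1.1) he

theorem gluedScope_mono {L K : Finset (glued m X A B).Elem} (h : L ⊆ K) :
    gluedScope L ⊆ gluedScope K :=
  Finset.biUnion_subset_biUnion_of_subset_left _ h

theorem card_gluedScope_le (K : Finset (glued m X A B).Elem) :
    (gluedScope K).card ≤ K.card * m :=
  Finset.card_biUnion_le_card_mul _ _ _ fun e _ => (gluedRep e).1.2

/-- The map from `K` to `B` induced by a partial homomorphism on the scope of `K`. -/
noncomputable def gluedEval (K : Finset (glued m X A B).Elem) (f : PartialHom X A (gluedScope K))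
    (v : K) : B.dom v.1.1 :=
  (gluedRep v.1).eval (gluedRep_subset_gluedScope v.2) f

variable [A.IsFinite] {k l : ℕ} {x : (K : Finset X.Elem) → PartialHom X A K → ℚ}

/-- A constraint of the glued structure comes from a single `U`, which need not lie in the scope of
`K`. Extending `f` to `U` within the support lets the chosen representatives be replaced by those
over `U`, where the relation holds coordinatewise. -/
theorem exists_partialHom_gluedEval (hx : IsSASolution l A X x) (hl : (k + 3) * m ≤ l)
    {K : Finset (glued m X A B).Elem} (hK : K.card ≤ k) {f : PartialHom X A (gluedScope K)}
    (hf : x _ f ≠ 0) : ∃ g : PartialHom (glued m X A B) B K, g.toFun = gluedEval K f := by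
  refine ⟨⟨gluedEval K f, ?_⟩, rfl⟩
  rintro r b ⟨U, y, hy, rfl⟩ hb
  have hKm : K.card * m ≤ k * m := Nat.mul_le_mul_right m hK
  have hW : (gluedScope K ∪ U.1).card ≤ l := by
    have := Finset.card_union_le (gluedScope K) U.1
    have := card_gluedScope_le K
    have := U.2
    linarith
  obtain ⟨g, rfl, hg⟩ := hx.exists_extension (K := gluedScope K ∪ U.1)
    Finset.subset_union_left hW hf
  have h := hy (g.restrict Finset.subset_union_right)
  convert h using 2 with i
  exact LocalElem.eval_eq_eval hx (by linarith [Nat.zero_le (k * m)]) (q := ⟨U, y i⟩) (Quot.out_eq _)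
    ((gluedRep_subset_gluedScope (hb i)).trans Finset.subset_union_left)
    Finset.subset_union_right hW hg

/-- No mass is lost in the pushforward: each `f` in the support induces exactly one partial
homomorphism, and the other `f` have weight zero. -/
theorem sum_gluedEval_eq [B.IsFinite] (hx : IsSASolution l A X x) (hl : (k + 3) * m ≤ l)
    {K : Finset (glued m X A B).Elem} (hK : K.card ≤ k)
    (P : ((v : K) → B.dom v.1.1) → Prop) :
    ∑ g : PartialHom (glued m X A B) B K with P g.toFun,
      ∑ f with gluedEval K f = g.toFun, x (gluedScope K) f =
    ∑ f with P (gluedEval K f), x (gluedScope K) f := by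
  simp only [Finset.sum_filter]
  simp only [← Finset.sum_filter (fun g : PartialHom (glued m X A B) B K => P g.toFun)]
  rw [Finset.sum_comm]
  refine Finset.sum_congr rfl fun f _ => ?_
  by_cases hf : x (gluedScope K) f = 0
  · simp [hf]
  · obtain ⟨G, hG⟩ := exists_partialHom_gluedEval hx hl hK hf
    have : ∀ g : PartialHom (glued m X A B) B K, G.toFun = g.toFun ↔ G = g :=
      fun g => ⟨PartialHom.ext, fun h => h ▸ rfl⟩
    simp [← hG, this]

theorem safeasible_glued [B.IsFinite] (hl : (k + 3) * m ≤ l) (h : SAFeasible l A X) :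
    SAFeasible k B (glued m X A B) := by
  obtain ⟨x, hx⟩ := h
  have hcard : ∀ K : Finset (glued m X A B).Elem, K.card ≤ k → (gluedScope K).card ≤ l := by
    intro K hK
    have := Nat.mul_le_mul_right m hK
    have := card_gluedScope_le K
    linarith
  have hsum : ∀ K : Finset (glued m X A B).Elem, K.card ≤ k →
      ∑ g : PartialHom (glued m X A B) B K,
        ∑ f with gluedEval K f = g.toFun, x (gluedScope K) f = 1 := by
    intro K hK
    have := sum_gluedEval_eq hx hl hK (fun _ => True)
    simp only [Finset.filter_true] at this
    rw [this, hx.sum_eq_one _ (hcard K hK)]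
  have hnonneg : ∀ K : Finset (glued m X A B).Elem, K.card ≤ k →
      ∀ g : PartialHom (glued m X A B) B K,
        0 ≤ ∑ f with gluedEval K f = g.toFun, x (gluedScope K) f := fun K hK g =>
    Finset.sum_nonneg fun f _ => (hx.mem_Icc _ (hcard K hK) f).1
  refine ⟨fun K g => ∑ f with gluedEval K f = g.toFun, x (gluedScope K) f, ?_, hsum, ?_⟩
  · intro K hK g
    refine ⟨hnonneg K hK g, ?_⟩
    rw [← hsum K hK]
    exact Finset.single_le_sum (f := fun g : PartialHom (glued m X A B) B K =>
      ∑ f with gluedEval K f = g.toFun, x (gluedScope K) f)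
      (fun g _ => hnonneg K hK g) (Finset.mem_univ g)
  · intro L K hLK hK g
    have hiff : ∀ g' : PartialHom (glued m X A B) B K, PartialHom.restrict hLK g' = g ↔
        (fun v : L => g'.toFun ⟨v.1, hLK v.2⟩) = g.toFun :=
      fun g' => ⟨fun h => h ▸ rfl, fun h => PartialHom.ext h⟩
    simp only [hiff]
    have hpush := sum_gluedEval_eq hx hl hK (fun b => (fun v : L => b ⟨v.1, hLK v.2⟩) = g.toFun)
    trans ∑ f with (fun v : L => gluedEval K f ⟨v.1, hLK v.2⟩) = g.toFun, x (gluedScope K) f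
    · convert hpush
    simp only [← hx.marginal _ _ (gluedScope_mono hLK) (hcard K hK)]
    -- Representatives do not depend on `K`, so `gluedEval` commutes with restriction and the sum
    -- splits over the restrictions to the scope of `L`.
    rw [← Finset.sum_fiberwise_of_maps_to (t := Finset.univ.filter fun f => gluedEval L f = g.toFun)
      (g := PartialHom.restrict (gluedScope_mono hLK)) (fun f hf => by
        simp only [Finset.mem_filter, Finset.mem_univ, true_and] at hf ⊢
        exact hf)]
    refine Finset.sum_congr rfl fun f hf => Finset.sum_congr ?_ fun _ _ => rfl
    ext f'
    simp only [Finset.mem_filter, Finset.mem_univ, true_and, and_iff_right_iff_imp] at hf ⊢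
    rintro rfl
    exact hf

end Gluing

theorem Signature.exists_len_le (S : Signature) [S.IsFinite] : ∃ m, 1 ≤ m ∧ ∀ R, S.len R ≤ m := by
  have := Signature.IsFinite.sym (S := S)
  obtain ⟨m, hm⟩ := (Set.finite_range S.len).bddAbove
  exact ⟨m + 1, by omega, fun R => (hm ⟨R, rfl⟩).trans (by omega)⟩

end PCSP

theorem corollary4p3 {S T : PCSP.Signature} [S.IsFinite] [T.IsFinite]
    (A : PCSP.Struct.{0} S) (A' : PCSP.Struct.{u} S) [A.IsFinite]
    (B : PCSP.Struct.{0} T) (B' : PCSP.Struct.{v} T) [B.IsFinite]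
    (hA : PCSP.MapsTo A A') (hB : PCSP.MapsTo B B')
    (hPol : Nonempty (PCSP.PolMinionHom B B' A A'))
    (hSA : PCSP.SolvedBySomeSALevel B B') :
    PCSP.SolvedBySomeSALevel A A' := by

  obtain ⟨ξ⟩ := hPol
  obtain ⟨k, _, _, hk⟩ := hSA
  obtain ⟨m, hm, hlen⟩ := S.exists_len_le
  refine ⟨(k + 3) * m, Nat.mul_pos (by omega) hm, fun X _ h => PCSP.safeasible_of_mapsTo _ h,
    fun X hX hXA' hfeas => ?_⟩
  by_contra
  refine hk (PCSP.glued m X A B) (PCSP.glued_isFinite hX) (fun h => ?_)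
    (PCSP.safeasible_glued le_rfl hfeas)
  exact hXA' (PCSP.mapsTo_of_glued_mapsTo ξ hm hlen h)
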